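/- Let $V=\mathbb{R}^n$ with a norm $\|\cdot\|$ (i.e. any finite-dimensional real normed space of dimension $n$), and put $S=\{v:\|v\|=1\}$. A closed set $C\subset V$ is a cone of rank $k\ge 1$ (a $k$-cone) if $lv\in C$ for all $v\in C$, $l\in\mathbb{R}$, and $k$ is the maximal dimension of a linear subspace contained in $C$; it is $k$-solid if $W\setminus\{0\}\subset\operatorname{Int}C$ for some $k$-dimensional subspace $W$. Write $x\sim y$ if $x-y\in C$ and $x\approx y$ if $x-y\in\operatorname{Int}C$. Let $\Phi:\mathbb{R}\times V\to V$ be a flow which is $C^{1,\alpha}$, $\alpha\in(0,1]$ (a $C^1$ map with locally $\alpha$-Hölder derivative), and strongly monotone with respect to a $k$-solid $k$-cone $C$: $x\sim y$ implies $\Phi_t(x)\sim\Phi_t(y)$ for $t\ge0$, and $x\sim y$, $x\neq y$ imply $\Phi_t(x)\approx\Phi_t(y)$ for $t>0$. Assume moreover $D_x\Phi_t(C\setminus\{0\})\subset\operatorname{Int}C$ for all $x\in V$, $t>0$. Let $O(x)=\{\Phi_t(x):t\ge0\}$ and $\omega(x)=\bigcap_{s\ge0}\overline{\{\Phi_t(x):t\ge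 s\}}$. Let $Q$ be the set of points $x$ whose orbit is pseudo-ordered: $O(x)\ne\{x\}$ and $O(x)$ contains two distinct points $a,b$ with $a\sim b$. Let $D\subset V$ be an open set which is $\omega$-compact, i.e. $O(x)$ is bounded for each $x\in D$ and $\bigcup_{x\in D}\omega(x)$ is bounded. For a compact invariant set $K$, a $k$-exponential separation along $K$ associated with $C$ consists of families of subspaces $(E_z)_{z\in K}$ of dimension $k$ and $(F_z)_{z\in K}$ of dimension $n-k$, continuous in $z$ for the gap metric, such that for all $z\in K$: $V=E_z\oplus F_z$; $D_z\Phi_tE_z=E_{\Phi_t(z)}$ and $D_z\Phi_tF_z\subset F_{\Phi_t(z)}$ for $t>0$; $E_z\subset\operatorname{Int}C\cup\{0\}$ and $F_z\cap C=\{0\}$; and, for some constants $M>0$ and $0<\gamma<1$ independent of $z$, $\|D_z\Phi_tw\|\le M\gamma^t\|D_z\Phi_tv\|$ for all $w\in F_z\cap S$, $v\in E_z\cap S$, $t\ge0$. The corresponding $k$-Lyapunov exponent of $z\in K$ is $$\lambda_{kz}=\limsup_{t\to+\infty}\frac1t\log\ \inf_{v\in E_z\cap S}\|D_z\Phi_tv\|.$$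 Theorem. Let $x\in D$. Then a $k$-exponential separation along $\omega(x)$ associated with $C$ exists, so that the exponents $\lambda_{kz}$, $z\in\omega(x)$, are available; and for every such separation, if $\lambda_{kz}>0$ for every $z\in\omega(x)$, then $x\in\overline{Q}$. -/

import Mathlib

open Set Filter Topology
open scoped NNReal

noncomputable section

namespace ConeFlow

variable {V : Type*} [NormedAddCommGroup V] [NormedSpace ℝ V]

/-! ### Cones of rank `k` -/

/-- `C` is a cone of rank `k ≥ 1`: a closed set, invariant under multiplication by all real scalars,
such that `k` is the maximal dimension of a linear subspace contained in `C`. -/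
structure IsCone (k : ℕ) (C : Set V) : Prop where
  one_le : 1 ≤ k
  isClosed : IsClosed C
  smul_mem : ∀ v ∈ C, ∀ l : ℝ, l • v ∈ C
  isGreatest : IsGreatest
    {d : ℕ | ∃ W : Submodule ℝ V, (W : Set V) ⊆ C ∧ Module.finrank ℝ W = d} k

/-- `C` is `k`-solid: some `k`-dimensional subspace lies in `Int C ∪ {0}`. -/
def IsSolid (k : ℕ) (C : Set V) : Prop :=
  ∃ W : Submodule ℝ V, Module.finrank ℝ W = k ∧ (W : Set V) \ {0} ⊆ interior C

/-- `x ∼ y`: the points `x` and `y` are ordered with respect to `C`. -/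
def Ordered (C : Set V) (x y : V) : Prop := x - y ∈ C

/-- `x ≈ y`: the points `x` and `y` are strongly ordered with respect to `C`. -/
def StronglyOrdered (C : Set V) (x y : V) : Prop := x - y ∈ interior C

/-! ### Flows -/

/-- The spatial derivative `D_x Φ_t`. -/
def spatialDeriv (Φ : Flow ℝ V) (t : ℝ) (x : V) : V →L[ℝ] V :=
  fderiv ℝ (fun y : V => Φ t y) x

/-- The flow, as a map `ℝ × V → V`, is `C¹` with locally `α`-Hölder derivative. -/
structure IsC1Holder (Φ : Flow ℝ V) (α : ℝ≥0) : Prop where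
  pos : 0 < α
  le_one : α ≤ 1
  contDiff : ContDiff ℝ 1 (fun p : ℝ × V => Φ p.1 p.2)
  holder : ∀ p : ℝ × V, ∃ U ∈ 𝓝 p, ∃ c : ℝ≥0,
    HolderOnWith c α (fderiv ℝ (fun q : ℝ × V => Φ q.1 q.2)) U

/-- The flow is strongly monotone with respect to the `k`-solid cone `C`. -/
structure IsStronglyMonotone (Φ : Flow ℝ V) (k : ℕ) (C : Set V) : Prop where
  isCone : IsCone k C
  isSolid : IsSolid k C
  monotone : ∀ x y : V, Ordered C x y → ∀ t : ℝ, 0 ≤ t → Ordered C (Φ t x) (Φ t y)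
  strong : ∀ x y : V, x ≠ y → Ordered C x y →
    ∀ t : ℝ, 0 < t → StronglyOrdered C (Φ t x) (Φ t y)

/-- The standing assumption on the flow: it is `C^{1,α}`-smooth, strongly monotone with respect to
the `k`-cone `C`, and `D_x Φ_t` maps `C \ {0}` into `Int C` for all `x` and all `t > 0`. -/
structure FWW (Φ : Flow ℝ V) (α : ℝ≥0) (k : ℕ) (C : Set V) : Prop where
  smooth : IsC1Holder Φ α
  stronglyMonotone : IsStronglyMonotone Φ k C
  deriv_mem : ∀ (x : V) (t : ℝ), 0 < t → ∀ v ∈ C, v ≠ 0 → spatialDeriv Φ t x v ∈ interior C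

/-- The (forward) orbit `O(x) = {Φ_t(x) : t ≥ 0}`. -/
def orbit (Φ : Flow ℝ V) (x : V) : Set V := (fun t : ℝ => Φ t x) '' Ici 0

/-- The `ω`-limit set of the point `x`: the intersection over `s` of the closures of
`{Φ_t(x) : t ≥ s}`. -/
def omega (Φ : Flow ℝ V) (x : V) : Set V := omegaLimit atTop (fun t y => Φ t y) {x}

/-- `D` is `ω`-compact: all orbits starting in `D` are bounded, and the union of their `ω`-limit
sets is bounded. -/
def IsOmegaCompact (Φ : Flow ℝ V) (D : Set V) : Prop :=
  (∀ x ∈ D, Bornology.IsBounded (orbit Φ x)) ∧ Bornology.IsBounded (⋃ x ∈ D, omega Φ x)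

/-- The orbit of `x` is pseudo-ordered: it is nontrivial and contains two distinct ordered
points. -/
def IsPseudoOrdered (Φ : Flow ℝ V) (C : Set V) (x : V) : Prop :=
  orbit Φ x ≠ {x} ∧ ∃ a ∈ orbit Φ x, ∃ b ∈ orbit Φ x, a ≠ b ∧ Ordered C a b

/-- The set `Q` of points with pseudo-ordered orbit. -/
def pseudoOrderedSet (Φ : Flow ℝ V) (C : Set V) : Set V := {x | IsPseudoOrdered Φ C x}

/-! ### Exponential separation and Lyapunov exponents -/

/-- The gap distance of two subspaces: the Hausdorff distance of their unit spheres, that is, the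
maximum of `sup_{v ∈ L₁ ∩ S} inf_{u ∈ L₂ ∩ S} ‖v - u‖` and of the same quantity with `L₁` and
`L₂` exchanged. -/
def gap (L₁ L₂ : Submodule ℝ V) : ℝ :=
  Metric.hausdorffDist ((L₁ : Set V) ∩ Metric.sphere 0 1) ((L₂ : Set V) ∩ Metric.sphere 0 1)

/-- `K × (Y_z)` is a `d`-dimensional continuous bundle: all fibres over `K` have dimension `d`, and
`z ↦ Y_z` is continuous on `K` for the gap distance. Values of `Y` outside `K` play no role. -/
structure IsContinuousBundle (d : ℕ) (K : Set V) (Y : V → Submodule ℝ V) : Prop where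
  finrank_eq : ∀ z ∈ K, Module.finrank ℝ (Y z) = d
  continuous : ∀ z ∈ K, Tendsto (fun y => gap (Y y) (Y z)) (𝓝[K] z) (𝓝 0)

/-- `V = E_z ⊕ F_z`, `z ∈ K`, is a `k`-exponential separation of `(Φ_t, DΦ_t)` along the compact
invariant set `K`, associated with the cone `C`. -/
structure IsExpSeparation (Φ : Flow ℝ V) (k : ℕ) (C K : Set V) (E F : V → Submodule ℝ V) :
    Prop where
  bundle_E : IsContinuousBundle k K E
  bundle_F : IsContinuousBundle (Module.finrank ℝ V - k) K F
  isCompl : ∀ z ∈ K, IsCompl (E z) (F z)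
  map_E : ∀ z ∈ K, ∀ t : ℝ, 0 < t →
    (E z).map (spatialDeriv Φ t z : V →ₗ[ℝ] V) = E (Φ t z)
  map_F : ∀ z ∈ K, ∀ t : ℝ, 0 < t →
    (F z).map (spatialDeriv Φ t z : V →ₗ[ℝ] V) ≤ F (Φ t z)
  separation : ∃ M γ : ℝ, 0 < M ∧ 0 < γ ∧ γ < 1 ∧
    ∀ z ∈ K, ∀ w ∈ F z, ‖w‖ = 1 → ∀ v ∈ E z, ‖v‖ = 1 → ∀ t : ℝ, 0 ≤ t →
      ‖spatialDeriv Φ t z w‖ ≤ M * γ ^ t * ‖spatialDeriv Φ t z v‖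
  E_subset : ∀ z ∈ K, (E z : Set V) ⊆ interior C ∪ {0}
  F_inter : ∀ z ∈ K, (F z : Set V) ∩ C = {0}

/-- The infimum norm `m(T|_L) = inf {‖T v‖ : v ∈ L, ‖v‖ = 1}`. -/
def infNorm (T : V →L[ℝ] V) (L : Submodule ℝ V) : ℝ :=
  sInf ((fun v => ‖T v‖) '' ((L : Set V) ∩ Metric.sphere 0 1))

/-- The `k`-Lyapunov exponent at `z` for the bundle `E`, the upper limit of
`log m(D_z Φ_t |_{E_z}) / t` as `t → +∞`, taken in the extended reals. -/
def lyapunovExponent (Φ : Flow ℝ V) (E : V → Submodule ℝ V) (z : V) : EReal :=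
  limsup (fun t : ℝ => ((Real.log (infNorm (spatialDeriv Φ t z) (E z)) / t : ℝ) : EReal)) atTop

end ConeFlow

end

namespace ConeFlow

/-! ### The linearized cocycle and its action on the cone. -/

section Cocycle

variable {V : Type*} [NormedAddCommGroup V] [NormedSpace ℝ V] {Φ : Flow ℝ V}

/-! Existence of a separation: over a compact invariant set, the linearized flow maps the cone into
its interior with a uniform margin. Vectors that never enter the cone are therefore exponentially
dominated by vectors of the cone (`FWW.exists_domination`). Domination makes the former a subspace
`F`. A limit of solid subspaces pushed forward from the remote past provides the complement `E`, the
vectors whose whole past lies in the cone. Both families have closed graph and constant dimension,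
hence are gap continuous.

Approximation by pseudo-ordered orbits: take `y` near `x` with `y - x` in the cone. Positive
exponents and domination force ordered pairs near `omega Φ x` to expand, so infinitely often the two
orbits are at least `δ` apart, with `δ` independent of `y`
(`IsExpSeparation.exists_frequently_norm_ge`). At those times `Φ t y - Φ t x` lies in the cone with
a uniform margin `κ` (`FWW.exists_order_margin`). Some such times bring `Φ t x` close to a limit
point `q` that an earlier point `Φ s x` also approximates. Once `y` is close enough to `x`, `Φ s y`
is close to `Φ t x`, so `Φ t y - Φ s y` is a small perturbation of `Φ t y - Φ t x`. It is then
nonzero and in the cone, so the orbit of `y` is pseudo-ordered. -/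

theorem contDiff_flow_apply (h : ContDiff ℝ 1 (fun p : ℝ × V => Φ p.1 p.2)) (t : ℝ) :
    ContDiff ℝ 1 (fun y : V => Φ t y) :=
  h.comp (contDiff_const.prodMk contDiff_id)

theorem hasStrictFDerivAt_flow (h : ContDiff ℝ 1 (fun p : ℝ × V => Φ p.1 p.2)) (t : ℝ) (z : V) :
    HasStrictFDerivAt (fun y : V => Φ t y) (spatialDeriv Φ t z) z :=
  (contDiff_flow_apply h t).contDiffAt.hasStrictFDerivAt one_ne_zero

theorem continuous_spatialDeriv (h : ContDiff ℝ 1 (fun p : ℝ × V => Φ p.1 p.2)) :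
    Continuous (fun p : ℝ × V => spatialDeriv Φ p.1 p.2) := by
  have h' : ContDiff ℝ 1 (Function.uncurry fun (p : ℝ × V) (y : V) => Φ p.1 y) :=
    h.comp ((contDiff_fst.comp contDiff_fst).prodMk contDiff_snd)
  exact (ContDiff.fderiv (n := 0) h' contDiff_snd (by norm_num)).continuous

theorem spatialDeriv_zero (z : V) : spatialDeriv Φ 0 z = ContinuousLinearMap.id ℝ V := by
  have : (fun y : V => Φ 0 y) = id := by ext y; exact Φ.map_zero_apply y
  rw [spatialDeriv, this, fderiv_id]

theorem spatialDeriv_add (h : ContDiff ℝ 1 (fun p : ℝ × V => Φ p.1 p.2)) (s t : ℝ) (z v : V) :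
    spatialDeriv Φ (s + t) z v = spatialDeriv Φ s (Φ t z) (spatialDeriv Φ t z v) := by
  have e : (fun y : V => Φ (s + t) y) = (fun y => Φ s y) ∘ (fun y => Φ t y) := by
    ext y; exact Φ.map_add s t y
  have := ((hasStrictFDerivAt_flow h s (Φ t z)).hasFDerivAt.comp z
    (hasStrictFDerivAt_flow h t z).hasFDerivAt).fderiv
  rw [← e] at this
  rw [spatialDeriv, this]
  rfl

theorem flow_neg_apply {V : Type*} [TopologicalSpace V] {Φ : Flow ℝ V} (t : ℝ) (z : V) : Φ (-t) (Φ t z) = z := by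
  have := Φ.map_add (-t) t z
  rw [neg_add_cancel] at this
  exact this.symm.trans (Φ.map_zero_apply z)

theorem flow_apply_neg {V : Type*} [TopologicalSpace V] {Φ : Flow ℝ V} (t : ℝ) (z : V) : Φ t (Φ (-t) z) = z := by
  simpa using flow_neg_apply (Φ := Φ) (-t) z

theorem flow_injective {V : Type*} [TopologicalSpace V] {Φ : Flow ℝ V} (t : ℝ) : Function.Injective (fun y : V => Φ t y) :=
  Function.LeftInverse.injective (g := fun y => Φ (-t) y) (flow_neg_apply t)

theorem spatialDeriv_neg_apply (h : ContDiff ℝ 1 (fun p : ℝ × V => Φ p.1 p.2)) (t : ℝ) (z v : V) :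
    spatialDeriv Φ (-t) (Φ t z) (spatialDeriv Φ t z v) = v := by
  rw [← spatialDeriv_add h, neg_add_cancel, spatialDeriv_zero]; rfl

theorem spatialDeriv_apply_neg (h : ContDiff ℝ 1 (fun p : ℝ × V => Φ p.1 p.2)) (t : ℝ) (z v : V) :
    spatialDeriv Φ t (Φ (-t) z) (spatialDeriv Φ (-t) z v) = v := by
  simpa using spatialDeriv_neg_apply h (-t) z v

theorem spatialDeriv_injective (h : ContDiff ℝ 1 (fun p : ℝ × V => Φ p.1 p.2)) (t : ℝ) (z : V) :
    Function.Injective (spatialDeriv Φ t z) :=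
  Function.LeftInverse.injective (spatialDeriv_neg_apply h t z)

theorem spatialDeriv_ne_zero (h : ContDiff ℝ 1 (fun p : ℝ × V => Φ p.1 p.2)) (t : ℝ) (z : V)
    {v : V} (hv : v ≠ 0) : spatialDeriv Φ t z v ≠ 0 := fun h0 =>
  hv (spatialDeriv_injective h t z (h0.trans (map_zero _).symm))

theorem exists_norm_spatialDeriv_le (h : ContDiff ℝ 1 (fun p : ℝ × V => Φ p.1 p.2)) {K : Set V}
    (hK : IsCompact K) : ∃ L : ℝ, 1 ≤ L ∧ ∀ t ∈ Icc (-1 : ℝ) 1, ∀ z ∈ K, ∀ v : V,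
      ‖spatialDeriv Φ t z v‖ ≤ L * ‖v‖ := by
  obtain ⟨L, hL⟩ := (isCompact_Icc (a := (-1 : ℝ)) (b := 1)).prod hK |>.exists_bound_of_continuousOn
    (continuous_spatialDeriv h).continuousOn
  refine ⟨max L 1, le_max_right _ _, fun t ht z hz v => ?_⟩
  refine (ContinuousLinearMap.le_opNorm _ v).trans ?_
  gcongr
  exact (hL (t, z) ⟨ht, hz⟩).trans (le_max_left _ _)

/-- The vectors at `z` which never enter the cone `C` under the forward linearized flow. -/
def stableSet (Φ : Flow ℝ V) (C : Set V) (z : V) : Set V :=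
  {w | ∀ t : ℝ, 0 ≤ t → spatialDeriv Φ t z w ∈ C → w = 0}

/-- The vectors at `z` which stay in the cone `C` under the backward linearized flow. -/
def unstableSet (Φ : Flow ℝ V) (C : Set V) (z : V) : Set V :=
  {v | ∀ t : ℝ, 0 ≤ t → spatialDeriv Φ (-t) z v ∈ C}

variable {α : ℝ≥0} {k : ℕ} {C : Set V}

theorem eq_zero_of_mem_stableSet {z w : V} (hw : w ∈ stableSet Φ C z) (hC : w ∈ C) : w = 0 :=
  hw 0 le_rfl (by rw [spatialDeriv_zero]; exact hC)

theorem disjoint_of_subset_stableSet {z : V} {W F : Submodule ℝ V} (hW : (W : Set V) ⊆ C)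
    (hF : (F : Set V) ⊆ stableSet Φ C z) : Disjoint W F :=
  Submodule.disjoint_def.2 fun _ hv hvF => eq_zero_of_mem_stableSet (hF hvF) (hW hv)

namespace FWW

variable (h : FWW Φ α k C)
include h

theorem zero_mem : (0 : V) ∈ C := by
  obtain ⟨W, hW, -⟩ := h.stronglyMonotone.isCone.isGreatest.1
  exact hW W.zero_mem

theorem smul_mem {v : V} (hv : v ∈ C) (l : ℝ) : l • v ∈ C :=
  h.stronglyMonotone.isCone.smul_mem v hv l

theorem isClosed : IsClosed C := h.stronglyMonotone.isCone.isClosed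

theorem contDiff : ContDiff ℝ 1 (fun p : ℝ × V => Φ p.1 p.2) := h.smooth.contDiff

theorem spatialDeriv_mem {t : ℝ} (ht : 0 ≤ t) (z : V) {v : V} (hv : v ∈ C) :
    spatialDeriv Φ t z v ∈ C := by
  rcases ht.eq_or_lt with rfl | ht
  · rw [spatialDeriv_zero]; exact hv
  · by_cases hv0 : v = 0
    · rw [hv0, map_zero]; exact h.zero_mem
    · exact interior_subset (h.deriv_mem z t ht v hv hv0)

theorem continuous_spatialDeriv_apply :
    Continuous (fun p : ℝ × V × V => spatialDeriv Φ p.1 p.2.1 p.2.2) :=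
  ((continuous_spatialDeriv h.contDiff).comp
    (continuous_fst.prodMk (continuous_fst.comp continuous_snd))).clm_apply
    (continuous_snd.comp continuous_snd)

/-- Entering the cone is an open condition: one more unit of time carries a nonzero vector of `C`
into `interior C`, and this persists under perturbation of the base point and the vector. -/
theorem isClosed_stableSet : IsClosed {p : V × V | p.2 ∈ stableSet Φ C p.1} := by
  rw [← isOpen_compl_iff, isOpen_iff_eventually]
  rintro ⟨z, w⟩ hp
  simp only [mem_compl_iff, mem_ofPred_eq, stableSet, not_forall] at hp ⊢
  obtain ⟨t, ht, hC, hw⟩ := hp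
  have h1 : spatialDeriv Φ (1 + t) z w ∈ interior C := by
    rw [spatialDeriv_add h.contDiff]
    exact h.deriv_mem _ _ one_pos _ hC (spatialDeriv_ne_zero h.contDiff t z hw)
  have h2 : Continuous fun p : V × V => spatialDeriv Φ (1 + t) p.1 p.2 :=
    h.continuous_spatialDeriv_apply.comp (continuous_const.prodMk continuous_id)
  filter_upwards [h2.continuousAt.preimage_mem_nhds (isOpen_interior.mem_nhds h1),
    continuous_snd.continuousAt.preimage_mem_nhds (isOpen_ne.mem_nhds hw)] with p hp hp'
  exact ⟨1 + t, by linarith, interior_subset hp, hp'⟩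

theorem isClosed_unstableSet : IsClosed {p : V × V | p.2 ∈ unstableSet Φ C p.1} := by
  have : {p : V × V | p.2 ∈ unstableSet Φ C p.1} =
      ⋂ t ∈ Ici (0 : ℝ), (fun p : V × V => spatialDeriv Φ (-t) p.1 p.2) ⁻¹' C := by
    ext p; simp [unstableSet]
  rw [this]
  refine isClosed_biInter fun t _ => h.isClosed.preimage ?_
  exact h.continuous_spatialDeriv_apply.comp (continuous_const.prodMk continuous_id)

theorem smul_mem_stableSet {z w : V} (hw : w ∈ stableSet Φ C z) (l : ℝ) :
    l • w ∈ stableSet Φ C z := by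
  intro t ht hC
  rcases eq_or_ne l 0 with rfl | hl
  · exact zero_smul _ _
  · rw [hw t ht, smul_zero]
    have := h.smul_mem hC l⁻¹
    rwa [map_smul, smul_smul, inv_mul_cancel₀ hl, one_smul] at this

theorem stableSet_map {z w : V} (t : ℝ) (hw : w ∈ stableSet Φ C z) :
    spatialDeriv Φ t z w ∈ stableSet Φ C (Φ t z) := by
  intro s hs hC
  rw [← spatialDeriv_add h.contDiff] at hC
  -- For negative `t` the time `s + t` may be negative; waiting a further `|t|` makes it nonnegative
  -- without leaving the cone.
  have h1 : spatialDeriv Φ (|t| + (s + t)) z w ∈ C := by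
    rw [spatialDeriv_add h.contDiff]
    exact h.spatialDeriv_mem (abs_nonneg t) _ hC
  rw [hw _ (by linarith [neg_abs_le t]) h1, map_zero]

theorem unstableSet_map {z v : V} (t : ℝ) (hv : v ∈ unstableSet Φ C z) :
    spatialDeriv Φ t z v ∈ unstableSet Φ C (Φ t z) := by
  intro s hs
  rw [← spatialDeriv_add h.contDiff]
  rcases le_total 0 (-s + t) with h0 | h0
  · refine h.spatialDeriv_mem h0 _ ?_
    simpa [spatialDeriv_zero] using hv 0 le_rfl
  · simpa using hv (-(-s + t)) (by linarith)

/-- The vector one unit of time earlier is still in `C`, and strong positivity over that unit pushes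
it into the interior. -/
theorem unstableSet_subset (z : V) : unstableSet Φ C z ⊆ interior C ∪ {0} := by
  intro v hv
  by_cases h0 : v = 0
  · exact Or.inr h0
  · left
    rw [← spatialDeriv_apply_neg h.contDiff 1 z v]
    exact h.deriv_mem _ _ one_pos _ (hv 1 zero_le_one) (spatialDeriv_ne_zero h.contDiff _ _ h0)

theorem exists_solid : ∃ W : Submodule ℝ V, Module.finrank ℝ W = k ∧ (W : Set V) ⊆ C := by
  obtain ⟨W, hW, hsub⟩ := h.stronglyMonotone.isSolid
  refine ⟨W, hW, fun v hv => ?_⟩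
  by_cases hv0 : v = 0
  · rw [hv0]; exact h.zero_mem
  · exact interior_subset (hsub ⟨hv, hv0⟩)

theorem finrank_le_of_subset {W : Submodule ℝ V} (hW : (W : Set V) ⊆ C) : Module.finrank ℝ W ≤ k :=
  h.stronglyMonotone.isCone.isGreatest.2 ⟨W, hW, rfl⟩

theorem finrank_map_spatialDeriv (t : ℝ) (z : V) (W : Submodule ℝ V) :
    Module.finrank ℝ (W.map (spatialDeriv Φ t z : V →ₗ[ℝ] V)) = Module.finrank ℝ W :=
  (Submodule.equivMapOfInjective _ (spatialDeriv_injective h.contDiff t z) W).finrank_eq.symm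

variable [FiniteDimensional ℝ V]

theorem le_finrank : k ≤ Module.finrank ℝ V := by
  obtain ⟨W, hW, -⟩ := h.exists_solid
  exact hW ▸ W.finrank_le

/-- Over a compact set, the cone is uniformly transverse to the vectors which never enter it. -/
theorem exists_norm_sub_ge {K : Set V} (hK : IsCompact K) :
    ∃ c : ℝ, 0 < c ∧ ∀ z ∈ K, ∀ u ∈ C, ∀ w ∈ stableSet Φ C z, c * ‖w‖ ≤ ‖u - w‖ := by
  have hS : IsCompact ((K ×ˢ Metric.sphere (0 : V) 1) ∩ {p : V × V | p.2 ∈ stableSet Φ C p.1}) :=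
    (hK.prod (isCompact_sphere 0 1)).inter_right h.isClosed_stableSet
  -- Unit stable vectors lie off the closed cone, so their distance to it has a positive minimum
  -- over a compact set; homogeneity does the rest.
  obtain ⟨c, hc, hcS⟩ := hS.exists_forall_le' (f := fun p : V × V => Metric.infDist p.2 C) (a := 0)
    ((Metric.continuous_infDist_pt C).comp continuous_snd).continuousOn (by
      rintro ⟨z, w⟩ ⟨⟨-, hw⟩, hwF⟩
      refine (h.isClosed.notMem_iff_infDist_pos ⟨0, h.zero_mem⟩).1 fun hwC => ?_
      have : w = 0 := eq_zero_of_mem_stableSet hwF hwC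
      simp [this] at hw)
  refine ⟨c, hc, fun z hz u hu w hw => ?_⟩
  rcases eq_or_ne w 0 with rfl | hw0
  · simp
  have hn : 0 < ‖w‖ := norm_pos_iff.2 hw0
  have h1 := hcS (z, ‖w‖⁻¹ • w) ⟨⟨hz, by simp [norm_smul, hn.ne']⟩, h.smul_mem_stableSet hw _⟩
  have h2 : Metric.infDist (‖w‖⁻¹ • w) C ≤ dist (‖w‖⁻¹ • w) (‖w‖⁻¹ • u) :=
    Metric.infDist_le_dist_of_mem (h.smul_mem hu _)
  rw [dist_eq_norm, ← smul_sub, norm_smul, norm_inv, norm_norm, norm_sub_rev] at h2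
  have h3 := h1.trans h2
  rwa [inv_mul_eq_div, le_div_iff₀ hn] at h3

/-- Over a compact set, the linearized time-one map sends the cone into itself with a uniform
margin. -/
theorem exists_margin {K : Set V} (hK : IsCompact K) :
    ∃ δ : ℝ, 0 < δ ∧ ∀ z ∈ K, ∀ v ∈ C, ∀ u : V, ‖u‖ ≤ δ * ‖v‖ → spatialDeriv Φ 1 z v + u ∈ C := by
  have hS : IsCompact ((fun p : V × V => spatialDeriv Φ 1 p.1 p.2) ''
      (K ×ˢ (C ∩ Metric.sphere (0 : V) 1))) :=
    (hK.prod ((isCompact_sphere 0 1).inter_left h.isClosed)).image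
      (h.continuous_spatialDeriv_apply.comp (continuous_const.prodMk continuous_id))
  obtain ⟨δ, hδ, hsub⟩ := hS.exists_cthickening_subset_open isOpen_interior (by
    rintro _ ⟨⟨z, v⟩, ⟨-, hvC, hv⟩, rfl⟩
    exact h.deriv_mem _ _ one_pos _ hvC (Metric.ne_of_mem_sphere hv one_ne_zero))
  refine ⟨δ, hδ, fun z hz v hv u hu => ?_⟩
  rcases eq_or_ne v 0 with rfl | hv0
  · rw [norm_zero, mul_zero, norm_le_zero_iff] at hu
    rw [hu, map_zero, add_zero]; exact h.zero_mem
  have hn : 0 < ‖v‖ := norm_pos_iff.2 hv0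
  have h1 : spatialDeriv Φ 1 z (‖v‖⁻¹ • v) + ‖v‖⁻¹ • u ∈ C := by
    refine interior_subset (hsub (Metric.mem_cthickening_of_dist_le _
      (spatialDeriv Φ 1 z (‖v‖⁻¹ • v)) _ _
      ⟨(z, ‖v‖⁻¹ • v), ⟨hz, h.smul_mem hv _, by simp [norm_smul, hn.ne']⟩, rfl⟩ ?_))
    rw [dist_eq_norm, add_sub_cancel_left, norm_smul, norm_inv, norm_norm, inv_mul_eq_div,
      div_le_iff₀ hn]
    exact hu
  have h2 := h.smul_mem h1 ‖v‖
  rwa [map_smul, ← smul_add, smul_smul, mul_inv_cancel₀ hn.ne', one_smul] at h2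

end FWW

end Cocycle

end ConeFlow

namespace ConeFlow

/-! ### Domination and the invariant splitting. -/

section Splitting

variable {V : Type*} [NormedAddCommGroup V] [NormedSpace ℝ V] [FiniteDimensional ℝ V]
  {Φ : Flow ℝ V} {α : ℝ≥0} {k : ℕ} {C : Set V}

namespace FWW

variable (h : FWW Φ α k C)
include h

/-- Vectors in the cone dominate exponentially the vectors which never enter it. -/
theorem exists_domination {K : Set V} (hK : IsCompact K) (hinv : ∀ t : ℝ, ∀ z ∈ K, Φ t z ∈ K) :
    ∃ M γ : ℝ, 0 < M ∧ 0 < γ ∧ γ < 1 ∧ ∀ z ∈ K, ∀ v ∈ C, ∀ w ∈ stableSet Φ C z, ∀ t : ℝ, 0 ≤ t →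
      ‖spatialDeriv Φ t z w‖ * ‖v‖ ≤ M * γ ^ t * ‖w‖ * ‖spatialDeriv Φ t z v‖ := by
  obtain ⟨c, hc, hcK⟩ := h.exists_norm_sub_ge hK
  obtain ⟨δ, hδ, hδK⟩ := h.exists_margin hK
  obtain ⟨L, hL, hLK⟩ := exists_norm_spatialDeriv_le h.contDiff hK
  have hL0 : 0 < L := by linarith
  -- Growth factor per unit time of the multiple of `w` that can be added to `v` without leaving the
  -- cone.
  set q : ℝ := 1 + δ * c / L with hq
  have hq1 : 1 < q := by have : 0 < δ * c / L := by positivity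
                         linarith
  have hq0 : 0 < q := by linarith
  -- If `v + s • w` has reached the cone, transversality bounds its image below by `c * s` times the
  -- image of `w`. The margin `δ` of the next step then absorbs an extra `s * (δ * c / L)` of `w`.
  have key : ∀ z ∈ K, ∀ v ∈ C, ∀ w ∈ stableSet Φ C z, w ≠ 0 → ∀ n : ℕ,
      spatialDeriv Φ (n + 1) z (v + (δ * ‖v‖ / (L * ‖w‖) * q ^ n) • w) ∈ C := by
    intro z hz v hv w hw hw0 n
    have hn : 0 < ‖w‖ := norm_pos_iff.2 hw0
    set a := δ * ‖v‖ / (L * ‖w‖) with ha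
    have ha0 : 0 ≤ a := by positivity
    induction n with
    | zero =>
      rw [Nat.cast_zero, zero_add, pow_zero, mul_one, map_add]
      refine hδK z hz v hv _ ?_
      rw [map_smul, norm_smul, Real.norm_of_nonneg ha0]
      calc a * ‖spatialDeriv Φ 1 z w‖ ≤ a * (L * ‖w‖) := by
            gcongr; exact hLK 1 (by simp) z hz w
        _ = δ * ‖v‖ := by rw [ha]; field_simp
    | succ n ih =>
      set s := a * q ^ n with hs
      have hs0 : 0 ≤ s := by positivity
      have e : v + (a * q ^ (n + 1)) • w = (v + s • w) + (s * (δ * c / L)) • w := by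
        rw [add_assoc, ← add_smul]; congr 2; rw [hs, hq]; ring
      have e2 : ((n + 1 : ℕ) : ℝ) + 1 = 1 + ((n : ℝ) + 1) := by push_cast; ring
      have hz' := hinv (n + 1) z hz
      rw [e2, spatialDeriv_add h.contDiff, e, map_add (spatialDeriv Φ (n + 1) z), map_add]
      refine hδK _ hz' _ ih _ ?_
      rw [map_smul, map_smul, norm_smul, Real.norm_of_nonneg (by positivity)]
      have h1 := hcK _ hz' _ (h.spatialDeriv_mem (by positivity : (0 : ℝ) ≤ n + 1) z hv) _
        (h.smul_mem_stableSet (h.stableSet_map (n + 1) hw) (-s))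
      rw [← map_smul, ← map_sub, neg_smul, sub_neg_eq_add, map_neg, norm_neg, map_smul, norm_smul,
        Real.norm_of_nonneg hs0] at h1
      have h2 := hLK 1 (by simp) _ hz' (spatialDeriv Φ (n + 1) z w)
      calc s * (δ * c / L) * ‖spatialDeriv Φ 1 (Φ (n + 1) z) (spatialDeriv Φ (n + 1) z w)‖
          ≤ s * (δ * c / L) * (L * ‖spatialDeriv Φ (n + 1) z w‖) := by gcongr
        _ = δ * (c * (s * ‖spatialDeriv Φ (n + 1) z w‖)) := by field_simp
        _ ≤ _ := by gcongr
  have key2 : ∀ z ∈ K, ∀ v ∈ C, ∀ w ∈ stableSet Φ C z, ∀ n : ℕ,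
      ‖spatialDeriv Φ (n + 1) z w‖ * ‖v‖ ≤
        L / (c * δ) * q⁻¹ ^ n * ‖w‖ * ‖spatialDeriv Φ (n + 1) z v‖ := by
    intro z hz v hv w hw n
    rcases eq_or_ne w 0 with rfl | hw0
    · simp
    have hn : 0 < ‖w‖ := norm_pos_iff.2 hw0
    set s := δ * ‖v‖ / (L * ‖w‖) * q ^ n with hs
    have hs0 : 0 ≤ s := by positivity
    -- The image of `v` is a cone vector minus `s` times a stable vector, so transversality bounds
    -- it below.
    have h1 := hcK _ (hinv (n + 1) z hz) _ (key z hz v hv w hw hw0 n) _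
      (h.smul_mem_stableSet (h.stableSet_map (n + 1) hw) s)
    rw [← map_smul, ← map_sub, add_sub_cancel_right, map_smul, norm_smul,
      Real.norm_of_nonneg hs0] at h1
    calc ‖spatialDeriv Φ (n + 1) z w‖ * ‖v‖
        = L / (c * δ) * q⁻¹ ^ n * ‖w‖ * (c * (s * ‖spatialDeriv Φ (n + 1) z w‖)) := by
          rw [hs, inv_pow]; field_simp
      _ ≤ _ := by gcongr
  refine ⟨L * (L / (c * δ)) * L * q, q⁻¹, by positivity, by positivity, inv_lt_one_of_one_lt₀ hq1,
    fun z hz v hv w hw t ht => ?_⟩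
  -- Real times are compared with the integer `n + 1` above `t`, at the cost of one factor `L` in
  -- each direction and a factor `q`.
  set n := ⌊t⌋₊ with hn
  have hn1 : (n : ℝ) ≤ t := Nat.floor_le ht
  have hn2 : t < n + 1 := Nat.lt_floor_add_one t
  have hz' := hinv (n + 1) z hz
  have h1 : ‖spatialDeriv Φ t z w‖ ≤ L * ‖spatialDeriv Φ (n + 1) z w‖ := by
    have := hLK (t - (n + 1)) ⟨by linarith, by linarith⟩ _ hz' (spatialDeriv Φ (n + 1) z w)
    rwa [← spatialDeriv_add h.contDiff, sub_add_cancel] at this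
  have h2 : ‖spatialDeriv Φ (n + 1) z v‖ ≤ L * ‖spatialDeriv Φ t z v‖ := by
    have := hLK (n + 1 - t) ⟨by linarith, by linarith⟩ _ (hinv t z hz) (spatialDeriv Φ t z v)
    rwa [← spatialDeriv_add h.contDiff, sub_add_cancel] at this
  have h3 : q⁻¹ ^ n ≤ q * q⁻¹ ^ t := by
    have : q⁻¹ ^ ((n : ℝ) + 1) ≤ q⁻¹ ^ t :=
      Real.rpow_le_rpow_of_exponent_ge (by positivity) (inv_le_one_of_one_le₀ hq1.le) hn2.le
    rw [Real.rpow_add_one (by positivity), Real.rpow_natCast] at this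
    calc q⁻¹ ^ n = q * (q⁻¹ ^ n * q⁻¹) := by field_simp
      _ ≤ _ := by gcongr
  calc ‖spatialDeriv Φ t z w‖ * ‖v‖ ≤ L * (‖spatialDeriv Φ (n + 1) z w‖ * ‖v‖) := by
        rw [← mul_assoc]; gcongr
    _ ≤ L * (L / (c * δ) * q⁻¹ ^ n * ‖w‖ * ‖spatialDeriv Φ (n + 1) z v‖) := by
        exact mul_le_mul_of_nonneg_left (key2 z hz v hv w hw n) hL0.le
    _ ≤ L * (L / (c * δ) * (q * q⁻¹ ^ t) * ‖w‖ * (L * ‖spatialDeriv Φ t z v‖)) := by gcongr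
    _ = _ := by ring

/-- Were the sum to enter the cone, domination would make both summands negligible against it,
contradicting the triangle inequality. -/
theorem add_mem_stableSet {K : Set V} (hK : IsCompact K) (hinv : ∀ t : ℝ, ∀ z ∈ K, Φ t z ∈ K)
    {z : V} (hz : z ∈ K) {w₁ w₂ : V} (hw₁ : w₁ ∈ stableSet Φ C z) (hw₂ : w₂ ∈ stableSet Φ C z) :
    w₁ + w₂ ∈ stableSet Φ C z := by
  obtain ⟨M, γ, hM, hγ, hγ1, hdom⟩ := h.exists_domination hK hinv
  intro t ht hC
  by_contra h0
  have hz' := hinv t z hz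
  set v := spatialDeriv Φ t z (w₁ + w₂) with hv
  have hv0 : 0 < ‖v‖ := norm_pos_iff.2 (spatialDeriv_ne_zero h.contDiff t z h0)
  set N := ‖spatialDeriv Φ t z w₁‖ + ‖spatialDeriv Φ t z w₂‖ with hN
  have hlim : Tendsto (fun s : ℝ => M * γ ^ s * N) atTop (𝓝 (M * 0 * N)) :=
    ((tendsto_rpow_atTop_of_base_lt_one γ (by linarith) hγ1).const_mul M).mul_const N
  rw [mul_zero, zero_mul] at hlim
  obtain ⟨s, hs, hs0⟩ := ((hlim.eventually (gt_mem_nhds hv0)).and (eventually_ge_atTop 0)).exists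
  have h1 := hdom _ hz' v hC _ (h.stableSet_map t hw₁) s hs0
  have h2 := hdom _ hz' v hC _ (h.stableSet_map t hw₂) s hs0
  have hsv : 0 < ‖spatialDeriv Φ s (Φ t z) v‖ :=
    norm_pos_iff.2 (spatialDeriv_ne_zero h.contDiff _ _ (norm_pos_iff.1 hv0))
  have h3 : ‖spatialDeriv Φ s (Φ t z) v‖ ≤ ‖spatialDeriv Φ s (Φ t z) (spatialDeriv Φ t z w₁)‖ +
      ‖spatialDeriv Φ s (Φ t z) (spatialDeriv Φ t z w₂)‖ := by
    rw [hv, map_add, map_add]; exact norm_add_le _ _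
  have h4 : ‖spatialDeriv Φ s (Φ t z) v‖ * ‖v‖ ≤ M * γ ^ s * N * ‖spatialDeriv Φ s (Φ t z) v‖ := by
    calc _ ≤ (‖spatialDeriv Φ s (Φ t z) (spatialDeriv Φ t z w₁)‖ +
      ‖spatialDeriv Φ s (Φ t z) (spatialDeriv Φ t z w₂)‖) * ‖v‖ := by gcongr
      _ ≤ _ := by rw [add_mul, hN]; linarith
  rw [mul_comm, mul_le_mul_iff_left₀ hsv] at h4
  linarith

/-- The vectors which never enter the cone form a subspace complementary to the cone. -/
theorem exists_stable_submodule {K : Set V} (hK : IsCompact K)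
    (hinv : ∀ t : ℝ, ∀ z ∈ K, Φ t z ∈ K) {z : V} (hz : z ∈ K) :
    ∃ F : Submodule ℝ V, (F : Set V) = stableSet Φ C z ∧
      Module.finrank ℝ F = Module.finrank ℝ V - k := by
  let F : Submodule ℝ V :=
    { carrier := stableSet Φ C z
      add_mem' := fun h₁ h₂ => h.add_mem_stableSet hK hinv hz h₁ h₂
      zero_mem' := fun _ _ _ => rfl
      smul_mem' := fun l _ hw => h.smul_mem_stableSet hw l }
  refine ⟨F, rfl, ?_⟩
  obtain ⟨W, hWk, hW⟩ := h.exists_solid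
  have h1 := Submodule.finrank_add_finrank_le_of_disjoint
    (disjoint_of_subset_stableSet (z := z) (F := F) hW subset_rfl)
  obtain ⟨G, hG⟩ := Submodule.exists_isCompl F
  have h2 := Submodule.finrank_add_eq_of_isCompl hG
  -- Every unit vector of `G` eventually enters the interior; compactness gives a common time. The
  -- image of `G` is then a subspace inside `C`, so its dimension is at most `k`.
  obtain ⟨n, hn⟩ : ∃ n : ℕ, (G : Set V) ∩ Metric.sphere 0 1 ⊆
      spatialDeriv Φ n z ⁻¹' interior C := by
    refine ((isCompact_sphere 0 1).inter_left G.closed_of_finiteDimensional).elim_directed_cover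
      (fun n : ℕ => spatialDeriv Φ n z ⁻¹' interior C)
      (fun n => isOpen_interior.preimage (spatialDeriv Φ n z).continuous) ?_ ?_
    · rintro u ⟨huG, hu⟩
      have hu0 : u ≠ 0 := Metric.ne_of_mem_sphere hu one_ne_zero
      have huF : u ∉ stableSet Φ C z := fun huF =>
        hu0 (Submodule.disjoint_def.1 hG.disjoint u huF huG)
      simp only [stableSet, mem_ofPred_eq, not_forall] at huF
      obtain ⟨t, ht, hC, -⟩ := huF
      obtain ⟨n, hn⟩ := exists_nat_gt t
      refine mem_iUnion.2 ⟨n, ?_⟩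
      have := h.deriv_mem (Φ t z) (n - t) (by linarith) _ hC (spatialDeriv_ne_zero h.contDiff t z hu0)
      rwa [← spatialDeriv_add h.contDiff, sub_add_cancel] at this
    · refine directed_of_isDirected_le fun m n hmn u hu => ?_
      rcases hmn.eq_or_lt with rfl | hmn
      · exact hu
      by_cases hu0 : spatialDeriv Φ m z u = 0
      · have : u = 0 := by_contra fun hne => spatialDeriv_ne_zero h.contDiff m z hne hu0
        subst this
        simpa using hu
      · have := h.deriv_mem (Φ m z) (n - m) (by simpa using hmn) _ (interior_subset hu) hu0
        rwa [← spatialDeriv_add h.contDiff, sub_add_cancel] at this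
  have h3 : Module.finrank ℝ G ≤ k := by
    rw [← h.finrank_map_spatialDeriv n z G]
    refine h.finrank_le_of_subset ?_
    rintro _ ⟨u, hu, rfl⟩
    rcases eq_or_ne u 0 with rfl | hu0
    · simpa using h.zero_mem
    have hnu : ‖u‖ ≠ 0 := norm_ne_zero_iff.2 hu0
    have := h.smul_mem (interior_subset (hn ⟨G.smul_mem ‖u‖⁻¹ hu, by simp [norm_smul, hnu]⟩)) ‖u‖
    rwa [map_smul, smul_smul, mul_inv_cancel₀ hnu, one_smul] at this
  omega

/-- The vectors staying in the cone in backward time form a subspace complementary to the vectors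
which never enter the cone. -/
theorem exists_unstable_submodule {K : Set V} (hK : IsCompact K)
    (hinv : ∀ t : ℝ, ∀ z ∈ K, Φ t z ∈ K) {z : V} (hz : z ∈ K) {F : Submodule ℝ V}
    (hF : (F : Set V) = stableSet Φ C z) (hFk : Module.finrank ℝ F = Module.finrank ℝ V - k) :
    ∃ E : Submodule ℝ V, (E : Set V) = unstableSet Φ C z ∧ IsCompl E F := by
  obtain ⟨W, hWk, hW⟩ := h.exists_solid
  obtain ⟨c, hc, hcK⟩ := h.exists_norm_sub_ge hK
  have hkn := h.le_finrank
  -- The solid subspace started at time `-n` and carried to `z`: its vectors have been in the cone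
  -- for the last `n` units of time.
  set Ls : ℕ → Submodule ℝ V := fun n => W.map (spatialDeriv Φ n (Φ (-n) z) : V →ₗ[ℝ] V) with hLs
  have hLC : ∀ n : ℕ, ∀ t : ℝ, 0 ≤ t → t ≤ n → ∀ v ∈ Ls n, spatialDeriv Φ (-t) z v ∈ C := by
    rintro n t - htn _ ⟨v, hv, rfl⟩
    have h1 := spatialDeriv_add h.contDiff (-t) n (Φ (-n) z) v
    rw [flow_apply_neg] at h1
    rw [ContinuousLinearMap.coe_coe, ← h1]
    exact h.spatialDeriv_mem (by linarith) _ (hW hv)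
  have hLC0 : ∀ n : ℕ, (Ls n : Set V) ⊆ C := fun n v hv => by
    simpa [spatialDeriv_zero] using hLC n 0 le_rfl n.cast_nonneg v hv
  have hcompl : ∀ n, IsCompl (Ls n) F := fun n => by
    refine (Submodule.isCompl_iff_disjoint _ _ ?_).2 (disjoint_of_subset_stableSet (hLC0 n) hF.subset)
    rw [hLs]
    simp only [h.finrank_map_spatialDeriv, hWk, hFk]
    omega
  let P : ℕ → V →L[ℝ] V := fun n => LinearMap.toContinuousLinearMap ((Ls n).projection F (hcompl n))
  have hPL : ∀ n v, P n v ∈ Ls n := fun n v => Submodule.projection_apply_mem (hcompl n) v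
  have hPF : ∀ n v, v - P n v ∈ F := fun n v => by
    have h1 : (Ls n).projection F (hcompl n) (v - P n v) = 0 := by
      rw [map_sub, Submodule.projection_apply_of_mem_left (hcompl n) (hPL n v)]
      exact sub_self _
    exact (Submodule.projection_apply_eq_zero_iff (hcompl n)).1 h1
  -- Transversality of cone and stable vectors bounds the projections along `F` uniformly, so a
  -- subsequence converges to some `Q`.
  have hPb : ∀ n, P n ∈ Metric.closedBall (0 : V →L[ℝ] V) (1 + c⁻¹) := fun n => by
    rw [mem_closedBall_zero_iff]
    refine ContinuousLinearMap.opNorm_le_bound _ (by positivity) fun v => ?_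
    have h1 := hcK z hz (P n v) (hLC0 n (hPL n v)) (-(v - P n v)) (hF.subset (F.neg_mem (hPF n v)))
    rw [norm_neg, sub_neg_eq_add, add_sub_cancel] at h1
    have h2 : ‖v - P n v‖ ≤ c⁻¹ * ‖v‖ := by rwa [inv_mul_eq_div, le_div_iff₀ hc, mul_comm]
    calc ‖P n v‖ = ‖v - (v - P n v)‖ := by rw [sub_sub_cancel]
      _ ≤ ‖v‖ + ‖v - P n v‖ := norm_sub_le _ _
      _ ≤ (1 + c⁻¹) * ‖v‖ := by linarith
  obtain ⟨Q, -, φ, hφ, hQ⟩ := (isCompact_closedBall (0 : V →L[ℝ] V) (1 + c⁻¹)).tendsto_subseq hPb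
  have hQv : ∀ v, Tendsto (fun n => P (φ n) v) atTop (𝓝 (Q v)) := fun v =>
    ((ContinuousLinearMap.apply ℝ V v).continuous.tendsto Q).comp hQ
  have hQF : ∀ v, v - Q v ∈ F := fun v =>
    F.closed_of_finiteDimensional.mem_of_tendsto (tendsto_const_nhds.sub (hQv v))
      (Eventually.of_forall fun n => hPF (φ n) v)
  have hQE : ∀ v, Q v ∈ unstableSet Φ C z := fun v t ht => by
    refine h.isClosed.mem_of_tendsto
      (((spatialDeriv Φ (-t) z).continuous.tendsto (Q v)).comp (hQv v)) ?_
    filter_upwards [hφ.tendsto_atTop.eventually_ge_atTop ⌈t⌉₊] with n hn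
    exact hLC (φ n) t ht (Nat.ceil_le.1 hn) _ (hPL (φ n) v)
  have hQEs : ((LinearMap.range (Q : V →ₗ[ℝ] V) : Submodule ℝ V) : Set V) ⊆ unstableSet Φ C z := by
    rintro _ ⟨v, rfl⟩; exact hQE v
  have hEC : ∀ v ∈ unstableSet Φ C z, v ∈ C := fun v hv => by
    simpa [spatialDeriv_zero] using hv 0 le_rfl
  refine ⟨LinearMap.range (Q : V →ₗ[ℝ] V), hQEs.antisymm fun v hv => ?_, ?_⟩
  · obtain ⟨M, γ, hM, hγ, hγ1, hdom⟩ := h.exists_domination hK hinv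
    have hf : v - Q v ∈ stableSet Φ C z := hF.subset (hQF v)
    have hlow : ∀ s : ℝ, 0 ≤ s →
        c * ‖spatialDeriv Φ (-s) z (v - Q v)‖ ≤ ‖spatialDeriv Φ (-s) z (Q v)‖ := fun s hs => by
      have := hcK _ (hinv (-s) z hz) _ (hv s hs) _ (h.stableSet_map (-s) hf)
      rwa [← map_sub, sub_sub_cancel] at this
    -- At time `-s` the stable part is at most `c⁻¹` times the image of `Q v`; flowing forward by
    -- `s`, domination shrinks this ratio by `M * γ ^ s`. Letting `s → ∞` gives `v = Q v`.
    have hf0 : ∀ s : ℝ, 0 ≤ s → ‖v - Q v‖ ≤ M * γ ^ s * (c⁻¹ * ‖Q v‖) := fun s hs => by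
      by_cases hq0 : Q v = 0
      · have := hlow 0 le_rfl
        rw [neg_zero, spatialDeriv_zero] at this
        simp only [ContinuousLinearMap.id_apply, hq0, norm_zero, sub_zero, mul_zero] at this ⊢
        exact le_of_mul_le_mul_left (this.trans_eq (mul_zero c).symm) hc
      have h1 := hdom _ (hinv (-s) z hz) _ (hQE v s hs) _ (h.stableSet_map (-s) hf) s hs
      rw [spatialDeriv_apply_neg h.contDiff, spatialDeriv_apply_neg h.contDiff] at h1
      have hpos : 0 < ‖spatialDeriv Φ (-s) z (Q v)‖ :=
        norm_pos_iff.2 (spatialDeriv_ne_zero h.contDiff _ _ hq0)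
      have h2 : ‖spatialDeriv Φ (-s) z (v - Q v)‖ ≤ c⁻¹ * ‖spatialDeriv Φ (-s) z (Q v)‖ := by
        rw [inv_mul_eq_div, le_div_iff₀ hc, mul_comm]; exact hlow s hs
      refine le_of_mul_le_mul_right (h1.trans ?_) hpos
      calc M * γ ^ s * ‖spatialDeriv Φ (-s) z (v - Q v)‖ * ‖Q v‖
          ≤ M * γ ^ s * (c⁻¹ * ‖spatialDeriv Φ (-s) z (Q v)‖) * ‖Q v‖ := by gcongr
        _ = _ := by ring
    have hlim : Tendsto (fun s : ℝ => M * γ ^ s * (c⁻¹ * ‖Q v‖)) atTop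
        (𝓝 (M * 0 * (c⁻¹ * ‖Q v‖))) :=
      ((tendsto_rpow_atTop_of_base_lt_one γ (by linarith) hγ1).const_mul M).mul_const _
    rw [mul_zero, zero_mul] at hlim
    have h0 : ‖v - Q v‖ ≤ 0 := ge_of_tendsto hlim ((eventually_ge_atTop 0).mono hf0)
    exact ⟨v, (sub_eq_zero.1 (norm_le_zero_iff.1 h0)).symm⟩
  · refine ⟨disjoint_of_subset_stableSet (fun v hv => hEC v (hQEs hv)) hF.subset,
      codisjoint_iff.2 (eq_top_iff.2 fun v _ => ?_)⟩
    rw [← add_sub_cancel (Q v) v]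
    exact Submodule.add_mem_sup ⟨v, rfl⟩ (hQF v)

end FWW
end Splitting
end ConeFlow

namespace ConeFlow

/-! ### Gap continuity and existence of the separation. -/

section Gap

variable {V : Type*} [NormedAddCommGroup V] [NormedSpace ℝ V]

theorem norm_inv_smul_sub_self {v : V} (hv : v ≠ 0) : ‖‖v‖⁻¹ • v - v‖ = |1 - ‖v‖| := by
  have hn : ‖v‖ ≠ 0 := norm_ne_zero_iff.2 hv
  have : ‖v‖⁻¹ • v - v = (‖v‖⁻¹ - 1) • v := by rw [sub_smul, one_smul]
  rw [this, norm_smul, Real.norm_eq_abs, ← abs_norm v, ← abs_mul, abs_norm, sub_mul,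
    inv_mul_cancel₀ hn, one_mul]

variable [FiniteDimensional ℝ V]

/-- A family of subspaces of constant dimension with closed graph is continuous for the gap. -/
theorem isContinuousBundle_of_isClosed {d : ℕ} {K : Set V} {Y : V → Submodule ℝ V}
    {G : Set (V × V)} (hG : IsClosed G) (hY : ∀ z ∈ K, ∀ v, v ∈ Y z ↔ (z, v) ∈ G)
    (hd : ∀ z ∈ K, Module.finrank ℝ (Y z) = d) : IsContinuousBundle d K Y := by
  refine ⟨hd, fun z hz => ?_⟩
  obtain ⟨G', hG'⟩ := Submodule.exists_isCompl (Y z)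
  let P : V →L[ℝ] V := LinearMap.toContinuousLinearMap ((Y z).projection G' hG')
  have hPmem : ∀ u, P u ∈ Y z := fun u => Submodule.projection_apply_mem hG' u
  have hPY : ∀ u ∈ Y z, P u = u := fun u hu => Submodule.projection_apply_of_mem_left hG' hu
  -- Upper semicontinuity: by the closed graph and compactness of the sphere, nearby fibres almost
  -- lie in `Y z`.
  have husc : ∀ ε : ℝ, 0 < ε → ∀ᶠ y in 𝓝[K] z, ∀ u ∈ Y y, ‖u - P u‖ ≤ ε * ‖u‖ := by
    intro ε hε
    have h1 : ∀ᶠ y in 𝓝 z, ∀ u ∈ Metric.sphere (0 : V) 1, (y, u) ∈ G → ‖u - P u‖ < ε := by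
      refine (isCompact_sphere 0 1).eventually_forall_of_forall_eventually fun u _ => ?_
      by_cases hu : (z, u) ∈ G
      · have h0 : ‖u - P u‖ < ε := by rwa [hPY u ((hY z hz u).2 hu), sub_self, norm_zero]
        have hc : Continuous fun p : V × V => ‖p.2 - P p.2‖ :=
          (continuous_snd.sub (P.continuous.comp continuous_snd)).norm
        filter_upwards [(hc.tendsto (z, u)).eventually (gt_mem_nhds h0)] with p hp _ using hp
      · filter_upwards [hG.isOpen_compl.mem_nhds hu] with p hp hp' using absurd hp' hp
    filter_upwards [mem_nhdsWithin_of_mem_nhds h1, self_mem_nhdsWithin] with y hy hyK u hu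
    rcases eq_or_ne u 0 with rfl | hu0
    · simp
    have hn : 0 < ‖u‖ := norm_pos_iff.2 hu0
    have h2 := hy (‖u‖⁻¹ • u) (by simp [norm_smul, hn.ne'])
      ((hY y hyK _).1 ((Y y).smul_mem _ hu))
    rw [map_smul, ← smul_sub, norm_smul, norm_inv, norm_norm, inv_mul_eq_div, div_lt_iff₀ hn] at h2
    exact h2.le
  rw [Metric.tendsto_nhds]
  intro ε hε
  have hε' : 0 < min (ε / 8) (1 / 2) := by positivity
  filter_upwards [husc _ hε', self_mem_nhdsWithin] with y hy hyK
  set η := min (ε / 8) (1 / 2) with hη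
  have hη1 : η ≤ 1 / 2 := min_le_right _ _
  have hη2 : 4 * η < ε := by have : η ≤ ε / 8 := min_le_left _ _
                             linarith
  rw [Real.dist_eq, sub_zero, gap, abs_of_nonneg Metric.hausdorffDist_nonneg]
  refine lt_of_le_of_lt ?_ hη2
  have hinj : ∀ u ∈ Y y, P u = 0 → u = 0 := fun u hu h0 => by
    have := hy u hu
    rw [h0, sub_zero] at this
    exact norm_le_zero_iff.1 (by nlinarith [norm_nonneg u])
  refine Metric.hausdorffDist_le_of_mem_dist (by positivity) ?_ ?_
  · rintro u ⟨hu, hu1⟩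
    have hu1 : ‖u‖ = 1 := by simpa using hu1
    have hu0 : u ≠ 0 := norm_ne_zero_iff.1 (by rw [hu1]; norm_num)
    have hP0 : P u ≠ 0 := fun h0 => hu0 (hinj u hu h0)
    have hd1 := hy u hu
    rw [hu1, mul_one] at hd1
    have hd2 : |1 - ‖P u‖| ≤ η := by
      rw [← hu1]; exact (abs_norm_sub_norm_le _ _).trans hd1
    refine ⟨‖P u‖⁻¹ • P u, ⟨(Y z).smul_mem _ (hPmem u), by
      simp [norm_smul, norm_ne_zero_iff.2 hP0]⟩, ?_⟩
    calc dist u (‖P u‖⁻¹ • P u) ≤ dist u (P u) + dist (P u) (‖P u‖⁻¹ • P u) := dist_triangle _ _ _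
      _ = ‖u - P u‖ + |1 - ‖P u‖| := by
        rw [dist_eq_norm, dist_comm, dist_eq_norm, norm_inv_smul_sub_self hP0]
      _ ≤ 4 * η := by linarith
  · rintro v ⟨hv, hv1⟩
    have hv1 : ‖v‖ = 1 := by simpa using hv1
    -- Equal dimensions turn injectivity of `P` on `Y y` into surjectivity onto `Y z`, giving the
    -- other half of the Hausdorff distance.
    have hmap : (Y y).map (P : V →ₗ[ℝ] V) = Y z := by
      refine Submodule.eq_of_le_of_finrank_eq ?_ ?_
      · rintro _ ⟨u, -, rfl⟩; exact hPmem u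
      · rw [hd z hz, ← hd y hyK]
        have hk : Function.Injective ((P : V →ₗ[ℝ] V).domRestrict (Y y)) := by
          rw [injective_iff_map_eq_zero]
          rintro ⟨u, hu⟩ h0
          exact Subtype.ext (hinj u hu h0)
        rw [← LinearMap.finrank_range_of_inj hk, LinearMap.range_domRestrict]
    obtain ⟨u, hu, huv⟩ : v ∈ (Y y).map (P : V →ₗ[ℝ] V) := by rw [hmap]; exact hv
    have huv : P u = v := huv
    have hu0 : u ≠ 0 := by
      rintro rfl
      rw [map_zero] at huv
      rw [← huv, norm_zero] at hv1
      norm_num at hv1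
    have hd1 := hy u hu
    rw [huv] at hd1
    have hd2 : |1 - ‖u‖| ≤ η * ‖u‖ := by
      rw [← hv1, abs_sub_comm]; exact (abs_norm_sub_norm_le _ _).trans hd1
    have hn : ‖u‖ ≤ 2 := by nlinarith [neg_abs_le (1 - ‖u‖), norm_nonneg u]
    refine ⟨‖u‖⁻¹ • u, ⟨(Y y).smul_mem _ hu, by simp [norm_smul, norm_ne_zero_iff.2 hu0]⟩, ?_⟩
    calc dist v (‖u‖⁻¹ • u) ≤ dist v u + dist u (‖u‖⁻¹ • u) := dist_triangle _ _ _
      _ = ‖u - v‖ + |1 - ‖u‖| := by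
        rw [dist_comm v, dist_eq_norm, dist_comm u, dist_eq_norm, norm_inv_smul_sub_self hu0]
      _ ≤ 4 * η := by nlinarith

/-- A flow satisfying the standing assumption admits an exponential separation along every compact
invariant set. -/
theorem FWW.exists_isExpSeparation {Φ : Flow ℝ V} {α : ℝ≥0} {k : ℕ} {C : Set V} (h : FWW Φ α k C)
    {K : Set V} (hK : IsCompact K) (hinv : ∀ t : ℝ, ∀ z ∈ K, Φ t z ∈ K) :
    ∃ E F : V → Submodule ℝ V, IsExpSeparation Φ k C K E F := by
  have hF' := fun z (hz : z ∈ K) => h.exists_stable_submodule hK hinv hz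
  choose! F hF hFk using hF'
  have hE' := fun z (hz : z ∈ K) => h.exists_unstable_submodule hK hinv hz (hF z hz) (hFk z hz)
  choose! E hE hEF using hE'
  have hkn := h.le_finrank
  have memE : ∀ z ∈ K, ∀ v, v ∈ E z ↔ v ∈ unstableSet Φ C z := fun z hz v => by
    rw [← hE z hz]; rfl
  have memF : ∀ z ∈ K, ∀ v, v ∈ F z ↔ v ∈ stableSet Φ C z := fun z hz v => by
    rw [← hF z hz]; rfl
  have hEC : ∀ z ∈ K, ∀ v ∈ E z, v ∈ C := fun z hz v hv => by
    simpa [spatialDeriv_zero] using (memE z hz v).1 hv 0 le_rfl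
  refine ⟨E, F, ⟨isContinuousBundle_of_isClosed h.isClosed_unstableSet memE fun z hz => ?_,
    isContinuousBundle_of_isClosed h.isClosed_stableSet memF hFk, hEF, fun z hz t _ => ?_,
    fun z hz t _ => ?_, ?_, fun z hz => (hE z hz).subset.trans (h.unstableSet_subset z),
    fun z hz => ?_⟩⟩
  · have := Submodule.finrank_add_eq_of_isCompl (hEF z hz)
    rw [hFk z hz] at this
    omega
  · refine le_antisymm ?_ fun v hv => ?_
    · rintro _ ⟨v, hv, rfl⟩
      exact (memE _ (hinv t z hz) _).2 (h.unstableSet_map t ((memE z hz v).1 hv))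
    · refine ⟨spatialDeriv Φ (-t) (Φ t z) v, (memE z hz _).2 ?_, ?_⟩
      · have := h.unstableSet_map (-t) ((memE _ (hinv t z hz) v).1 hv)
        rwa [flow_neg_apply] at this
      · have := spatialDeriv_apply_neg h.contDiff t (Φ t z) v
        rwa [flow_neg_apply] at this
  · rintro _ ⟨v, hv, rfl⟩
    exact (memF _ (hinv t z hz) _).2 (h.stableSet_map t ((memF z hz v).1 hv))
  · obtain ⟨M, γ, hM, hγ, hγ1, hdom⟩ := h.exists_domination hK hinv
    refine ⟨M, γ, hM, hγ, hγ1, fun z hz w hw hw1 v hv hv1 t ht => ?_⟩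
    have := hdom z hz v (hEC z hz v hv) w ((memF z hz w).1 hw) t ht
    rwa [hw1, hv1, mul_one, mul_one] at this
  · ext v
    exact ⟨fun hv => eq_zero_of_mem_stableSet ((memF z hz v).1 hv.1) hv.2, fun hv => by
      rw [mem_singleton_iff.1 hv]; exact ⟨(F z).zero_mem, h.zero_mem⟩⟩

end Gap

end ConeFlow

namespace ConeFlow

/-! ### Limit sets of bounded orbits. -/

section Omega

variable {V : Type*} [NormedAddCommGroup V] {Φ : Flow ℝ V} {x : V}

theorem eventually_mem_closure_orbit :
    ∀ᶠ t : ℝ in atTop, MapsTo (fun y => Φ t y) {x} (closure (orbit Φ x)) :=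
  (eventually_ge_atTop 0).mono fun t ht y hy => by
    rw [mem_singleton_iff.1 hy]; exact subset_closure ⟨t, ht, rfl⟩

/-- Negative `t` is included, since any translation preserves `atTop`; the construction of `E` flows
backward. -/
theorem omega_invariant (t : ℝ) : ∀ z ∈ omega Φ x, Φ t z ∈ omega Φ x :=
  Flow.isInvariant_omegaLimit atTop Φ {x} (fun t => tendsto_atTop_add_const_left _ t tendsto_id) t

theorem isPseudoOrdered_of_ordered {C : Set V} {y : V} {s t : ℝ} (hs : 0 ≤ s) (ht : 0 ≤ t)
    (hne : Φ s y ≠ Φ t y) (hC : Ordered C (Φ s y) (Φ t y)) : IsPseudoOrdered Φ C y := by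
  have hs' : Φ s y ∈ orbit Φ y := ⟨s, hs, rfl⟩
  have ht' : Φ t y ∈ orbit Φ y := ⟨t, ht, rfl⟩
  refine ⟨fun heq => hne ?_, _, hs', _, ht', hne, hC⟩
  rw [heq] at hs' ht'
  exact hs'.trans ht'.symm

variable [ProperSpace V]

theorem isCompact_omega (hb : Bornology.IsBounded (orbit Φ x)) : IsCompact (omega Φ x) := by
  refine hb.isCompact_closure.of_isClosed_subset (isClosed_omegaLimit _ _ _) ?_
  refine (omegaLimit_subset_closure_image2 _ _ _ (Ici_mem_atTop 0)).trans (closure_mono ?_)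
  rintro _ ⟨t, ht, y, hy, rfl⟩
  rw [mem_singleton_iff.1 hy]; exact ⟨t, ht, rfl⟩

theorem eventually_mem_of_omega_subset (hb : Bornology.IsBounded (orbit Φ x)) {U : Set V}
    (hU : IsOpen U) (hsub : omega Φ x ⊆ U) : ∀ᶠ t : ℝ in atTop, Φ t x ∈ U :=
  (eventually_mapsTo_of_isCompact_absorbing_of_isOpen_of_omegaLimit_subset atTop
    (fun (t : ℝ) y => Φ t y) {x} hb.isCompact_closure eventually_mem_closure_orbit hU hsub).mono
    fun _ ht => ht rfl

/-- If a property of times holds frequently, the orbit accumulates along these times at a point of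
the limit set. -/
theorem exists_mem_omega_frequently (hb : Bornology.IsBounded (orbit Φ x)) {p : ℝ → Prop}
    (hp : ∃ᶠ t in atTop, p t) :
    ∃ z ∈ omega Φ x, ∀ ε : ℝ, 0 < ε → ∃ᶠ t in atTop, p t ∧ ‖Φ t x - z‖ < ε := by
  have hne : NeBot ((atTop : Filter ℝ) ⊓ 𝓟 {t | p t}) := frequently_mem_iff_neBot.1 hp
  have hle : map (fun t => Φ t x) ((atTop : Filter ℝ) ⊓ 𝓟 {t | p t}) ≤ 𝓟 (closure (orbit Φ x)) :=
    le_principal_iff.2 (mem_inf_of_left (eventually_mem_closure_orbit.mono fun _ ht => ht rfl))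
  obtain ⟨z, -, hz⟩ := hb.isCompact_closure hle
  refine ⟨z, ?_, fun ε hε => ?_⟩
  · rw [omega, mem_omegaLimit_singleton_iff_mapClusterPt]
    exact hz.mono (map_mono inf_le_left)
  · have h1 : ∃ᶠ t in (atTop : Filter ℝ) ⊓ 𝓟 {t | p t}, Φ t x ∈ Metric.ball z ε :=
      MapClusterPt.frequently hz (Metric.ball_mem_nhds z hε)
    rw [frequently_inf_principal] at h1
    refine h1.mono fun t ht => ⟨ht.1, ?_⟩
    rw [← dist_eq_norm]; exact ht.2

end Omega

/-! ### Expansion of ordered pairs and pseudo-ordered orbits. -/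

section Expansion

variable {V : Type*} [NormedAddCommGroup V] [NormedSpace ℝ V]

theorem infNorm_nonneg (T : V →L[ℝ] V) (L : Submodule ℝ V) : 0 ≤ infNorm T L :=
  Real.sInf_nonneg (by rintro _ ⟨v, -, rfl⟩; exact norm_nonneg _)

theorem infNorm_mul_norm_le (T : V →L[ℝ] V) {L : Submodule ℝ V} {v : V} (hv : v ∈ L) :
    infNorm T L * ‖v‖ ≤ ‖T v‖ := by
  rcases eq_or_ne v 0 with rfl | hv0
  · simp
  have hn : 0 < ‖v‖ := norm_pos_iff.2 hv0
  have h1 : infNorm T L ≤ ‖T (‖v‖⁻¹ • v)‖ :=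
    csInf_le ⟨0, by rintro _ ⟨v, -, rfl⟩; exact norm_nonneg _⟩
      ⟨_, ⟨L.smul_mem _ hv, by simp [norm_smul, hn.ne']⟩, rfl⟩
  rwa [map_smul, norm_smul, norm_inv, norm_norm, inv_mul_eq_div, le_div_iff₀ hn] at h1

variable {Φ : Flow ℝ V} {α : ℝ≥0} {k : ℕ} {C : Set V}

/-- On a compact set, distinct ordered points whose images stay apart have images which are
ordered with a uniform margin. -/
theorem FWW.exists_order_margin (h : FWW Φ α k C) {R : Set V} (hR : IsCompact R) {δ : ℝ}
    (hδ : 0 < δ) : ∃ κ : ℝ, 0 < κ ∧ ∀ a ∈ R, ∀ b ∈ R, a - b ∈ C → δ ≤ ‖Φ 1 a - Φ 1 b‖ →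
      ∀ u : V, ‖u‖ ≤ κ → Φ 1 a - Φ 1 b + u ∈ C := by
  have hcont : Continuous fun p : V × V => Φ 1 p.1 - Φ 1 p.2 :=
    ((contDiff_flow_apply h.contDiff 1).continuous.comp continuous_fst).sub
      ((contDiff_flow_apply h.contDiff 1).continuous.comp continuous_snd)
  have hS : IsCompact ((fun p : V × V => Φ 1 p.1 - Φ 1 p.2) ''
      ((R ×ˢ R) ∩ ((fun p => p.1 - p.2) ⁻¹' C ∩ {p | δ ≤ ‖Φ 1 p.1 - Φ 1 p.2‖}))) :=
    ((hR.prod hR).inter_right ((h.isClosed.preimage (continuous_fst.sub continuous_snd)).inter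
      (isClosed_le continuous_const hcont.norm))).image hcont
  obtain ⟨κ, hκ, hsub⟩ := hS.exists_cthickening_subset_open isOpen_interior (by
    rintro _ ⟨⟨a, b⟩, ⟨-, hC, hab⟩, rfl⟩
    refine h.stronglyMonotone.strong a b ?_ hC 1 one_pos
    rintro rfl
    have hab : δ ≤ ‖Φ 1 a - Φ 1 a‖ := hab
    rw [sub_self, norm_zero] at hab
    linarith)
  refine ⟨κ, hκ, fun a ha b hb hC hab u hu => interior_subset (hsub
    (Metric.mem_cthickening_of_dist_le _ (Φ 1 a - Φ 1 b) _ _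
      ⟨(a, b), ⟨⟨ha, hb⟩, hC, hab⟩, rfl⟩ ?_))⟩
  rwa [dist_eq_norm, add_sub_cancel_left]

theorem FWW.exists_mem_ne_zero (h : FWW Φ α k C) : ∃ e ∈ C, e ≠ 0 := by
  obtain ⟨W, hWk, hW⟩ := h.exists_solid
  have hk := h.stronglyMonotone.isCone.one_le
  obtain ⟨e, he, he0⟩ := W.exists_mem_ne_zero_of_ne_bot (by
    rintro rfl
    rw [finrank_bot] at hWk
    omega)
  exact ⟨e, hW he, he0⟩

variable [FiniteDimensional ℝ V]

/-- At a point with positive exponent, the linearized flow expands the cone by any prescribed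
factor at some positive time. -/
theorem IsExpSeparation.exists_expansion (h : FWW Φ α k C) {K : Set V} {E F : V → Submodule ℝ V}
    (hEF : IsExpSeparation Φ k C K E F) {z : V} (hz : z ∈ K)
    (hlam : 0 < lyapunovExponent Φ E z) (B : ℝ) :
    ∃ τ : ℝ, 0 < τ ∧ ∀ v ∈ C, B * ‖v‖ ≤ ‖spatialDeriv Φ τ z v‖ := by
  obtain ⟨M, γ, hM, hγ, hγ1, hdom⟩ := hEF.separation
  have hcompl := hEF.isCompl z hz
  let P : V →L[ℝ] V := LinearMap.toContinuousLinearMap ((E z).projection (F z) hcompl)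
  have hPE : ∀ v, P v ∈ E z := fun v => Submodule.projection_apply_mem hcompl v
  have hP0 : ∀ v, P v = 0 → v ∈ F z := fun v hv =>
    (Submodule.projection_apply_eq_zero_iff hcompl).1 hv
  have hPF : ∀ v, v - P v ∈ F z := fun v => hP0 _ (by
    rw [map_sub, sub_eq_zero]
    exact (Submodule.projection_apply_of_mem_left hcompl (hPE v)).symm)
  -- Since `F z` meets `C` only at `0`, the `E`-component of a cone vector is uniformly comparable
  -- to the vector.
  obtain ⟨c, hc, hcS⟩ := ((isCompact_sphere (0 : V) 1).inter_left h.isClosed).exists_forall_le'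
    (f := fun v => ‖P v‖) (a := 0) P.continuous.norm.continuousOn (by
      rintro v ⟨hvC, hv⟩
      refine norm_pos_iff.2 fun h0 => Metric.ne_of_mem_sphere hv one_ne_zero ?_
      have : v ∈ (F z : Set V) ∩ C := ⟨hP0 v h0, hvC⟩
      rwa [hEF.F_inter z hz] at this)
  have hcC : ∀ v ∈ C, c * ‖v‖ ≤ ‖P v‖ := fun v hv => by
    rcases eq_or_ne v 0 with rfl | hv0
    · simp
    have hn : 0 < ‖v‖ := norm_pos_iff.2 hv0
    have h1 := hcS (‖v‖⁻¹ • v) ⟨h.smul_mem hv _, by simp [norm_smul, hn.ne']⟩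
    rwa [map_smul, norm_smul, norm_inv, norm_norm, inv_mul_eq_div, le_div_iff₀ hn] at h1
  have hdom' : ∀ w ∈ F z, ∀ v ∈ E z, ∀ t : ℝ, 0 ≤ t →
      ‖spatialDeriv Φ t z w‖ * ‖v‖ ≤ M * γ ^ t * ‖spatialDeriv Φ t z v‖ * ‖w‖ := by
    intro w hw v hv t ht
    rcases eq_or_ne w 0 with rfl | hw0
    · simp
    rcases eq_or_ne v 0 with rfl | hv0
    · simp
    have hnw : 0 < ‖w‖ := norm_pos_iff.2 hw0
    have hnv : 0 < ‖v‖ := norm_pos_iff.2 hv0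
    have h1 := hdom z hz (‖w‖⁻¹ • w) ((F z).smul_mem _ hw) (by simp [norm_smul, hnw.ne'])
      (‖v‖⁻¹ • v) ((E z).smul_mem _ hv) (by simp [norm_smul, hnv.ne']) t ht
    rw [map_smul, map_smul, norm_smul, norm_smul, norm_inv, norm_inv, norm_norm, norm_norm,
      inv_mul_eq_div, inv_mul_eq_div, ← mul_div_assoc, div_le_div_iff₀ hnw hnv] at h1
    exact h1
  set b : ℝ := (1 + ‖P‖) / c with hb
  have hb0 : 0 ≤ b := by positivity
  -- At such times the image of the `F`-component is at most half that of the `E`-component.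
  have hlow : ∀ v ∈ C, ∀ t : ℝ, 0 ≤ t → M * γ ^ t * b ≤ 1 / 2 →
      infNorm (spatialDeriv Φ t z) (E z) * (c / 2) * ‖v‖ ≤ ‖spatialDeriv Φ t z v‖ := by
    intro v hv t ht hts
    rcases eq_or_ne v 0 with rfl | hv0
    · simp
    have hnv : 0 < ‖v‖ := norm_pos_iff.2 hv0
    have h1 := hcC v hv
    have h0 : 0 < ‖P v‖ := lt_of_lt_of_le (by positivity) h1
    have h2 := hdom' _ (hPF v) _ (hPE v) t ht
    have h3 : ‖v - P v‖ ≤ b * ‖P v‖ := by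
      calc ‖v - P v‖ ≤ ‖v‖ + ‖P‖ * ‖v‖ := (norm_sub_le _ _).trans (by gcongr; exact P.le_opNorm v)
        _ = b * (c * ‖v‖) := by rw [hb]; field_simp
        _ ≤ _ := by gcongr
    have h4 : ‖spatialDeriv Φ t z (v - P v)‖ ≤ 1 / 2 * ‖spatialDeriv Φ t z (P v)‖ := by
      refine le_of_mul_le_mul_right (h2.trans ?_) h0
      calc M * γ ^ t * ‖spatialDeriv Φ t z (P v)‖ * ‖v - P v‖
          ≤ M * γ ^ t * ‖spatialDeriv Φ t z (P v)‖ * (b * ‖P v‖) := by gcongr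
        _ = (M * γ ^ t * b) * ‖spatialDeriv Φ t z (P v)‖ * ‖P v‖ := by ring
        _ ≤ _ := by gcongr
    have h5 : ‖spatialDeriv Φ t z (P v)‖ ≤
        ‖spatialDeriv Φ t z v‖ + ‖spatialDeriv Φ t z (v - P v)‖ := by
      have : spatialDeriv Φ t z (P v) = spatialDeriv Φ t z v - spatialDeriv Φ t z (v - P v) := by
        rw [← map_sub, sub_sub_cancel]
      rw [this]; exact norm_sub_le _ _
    have h6 := infNorm_mul_norm_le (spatialDeriv Φ t z) (hPE v)
    have h7 : infNorm (spatialDeriv Φ t z) (E z) * (c * ‖v‖) ≤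
        infNorm (spatialDeriv Φ t z) (E z) * ‖P v‖ :=
      mul_le_mul_of_nonneg_left h1 (infNorm_nonneg _ _)
    linarith
  obtain ⟨r, hr0, hr⟩ := EReal.lt_iff_exists_real_btwn.1 hlam
  have hr0 : 0 < r := by exact_mod_cast hr0
  have hfreq := frequently_lt_of_lt_limsup (by isBoundedDefault) hr
  have hsmall : ∀ᶠ t : ℝ in atTop, M * γ ^ t * b ≤ 1 / 2 := by
    have hlim : Tendsto (fun s : ℝ => M * γ ^ s * b) atTop (𝓝 (M * 0 * b)) :=
      ((tendsto_rpow_atTop_of_base_lt_one γ (by linarith) hγ1).const_mul M).mul_const _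
    rw [mul_zero, zero_mul] at hlim
    exact hlim.eventually (ge_mem_nhds (by norm_num))
  have hlarge : ∀ᶠ t : ℝ in atTop, 2 * B / c ≤ Real.exp (r * t) :=
    (Real.tendsto_exp_atTop.comp (tendsto_id.const_mul_atTop hr0)).eventually_ge_atTop _
  obtain ⟨t, htr, ht1, ht2, ht0⟩ :=
    (hfreq.and_eventually (hsmall.and (hlarge.and (eventually_gt_atTop 0)))).exists
  refine ⟨t, ht0, fun v hv => le_trans ?_ (hlow v hv t ht0.le ht1)⟩
  have htr : r < Real.log (infNorm (spatialDeriv Φ t z) (E z)) / t := by exact_mod_cast htr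
  rw [lt_div_iff₀ ht0] at htr
  have hpos : 0 < infNorm (spatialDeriv Φ t z) (E z) := by
    -- The convention `Real.log 0 = 0` is harmless, because the logarithm exceeds `r * t > 0`.
    refine (infNorm_nonneg _ _).lt_of_ne fun h0 => ?_
    rw [← h0, Real.log_zero] at htr
    nlinarith
  have hexp := (Real.lt_log_iff_exp_lt hpos).1 htr
  have h8 := ht2.trans hexp.le
  rw [div_le_iff₀ hc] at h8
  gcongr
  linarith

/-- Near a compact set with positive exponents, ordered pairs of points are expanded. -/
theorem IsExpSeparation.exists_forall_expansion (h : FWW Φ α k C) {K : Set V} (hK : IsCompact K)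
    {E F : V → Submodule ℝ V} (hEF : IsExpSeparation Φ k C K E F)
    (hlam : ∀ z ∈ K, 0 < lyapunovExponent Φ E z) :
    ∃ δ : ℝ, 0 < δ ∧ ∀ z ∈ K, ∀ a b : V, dist a z < δ → dist b z < δ → a - b ∈ C →
      ∃ τ : ℝ, 0 < τ ∧ 2 * ‖a - b‖ ≤ ‖Φ τ a - Φ τ b‖ := by
  set O : Set (V × V) := {p | p.1 - p.2 ∈ C →
    ∃ τ : ℝ, 0 < τ ∧ 2 * ‖p.1 - p.2‖ ≤ ‖Φ τ p.1 - Φ τ p.2‖} with hO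
  have hdiag : (fun z => (z, z)) '' K ⊆ interior O := by
    rintro _ ⟨z, hz, rfl⟩
    -- Factor `3`: strict differentiability costs `1`, leaving the required `2`.
    obtain ⟨τ, hτ, hexp⟩ := hEF.exists_expansion h hz (hlam z hz) 3
    rw [mem_interior_iff_mem_nhds]
    filter_upwards [(hasStrictFDerivAt_flow h.contDiff τ z).isLittleO.def one_pos] with p hp hpC
    refine ⟨τ, hτ, ?_⟩
    have h1 := hexp _ hpC
    have h2 := norm_sub_le_norm_add (spatialDeriv Φ τ z (p.1 - p.2))
      (Φ τ p.1 - Φ τ p.2 - spatialDeriv Φ τ z (p.1 - p.2))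
    rw [add_sub_cancel] at h2
    linarith
  obtain ⟨δ, hδ, hsub⟩ := (hK.image (continuous_id.prodMk continuous_id)).exists_thickening_subset_open
    isOpen_interior hdiag
  refine ⟨δ, hδ, fun z hz a b ha hb hab => ?_⟩
  exact interior_subset (hsub (Metric.mem_thickening_iff.2
    ⟨(z, z), ⟨z, hz, rfl⟩, by rw [Prod.dist_eq]; exact max_lt ha hb⟩) :
      (a, b) ∈ interior O) hab

/-- If the exponents on the limit set of `x` are positive, then every other point ordered with
respect to `x` is repeatedly driven away from the orbit of `x`. -/
theorem IsExpSeparation.exists_frequently_norm_ge (h : FWW Φ α k C) {x : V}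
    (hb : Bornology.IsBounded (orbit Φ x)) {E F : V → Submodule ℝ V}
    (hEF : IsExpSeparation Φ k C (omega Φ x) E F)
    (hlam : ∀ z ∈ omega Φ x, 0 < lyapunovExponent Φ E z) :
    ∃ δ : ℝ, 0 < δ ∧ ∀ y : V, y - x ∈ C → y ≠ x →
      ∃ᶠ t : ℝ in atTop, δ ≤ ‖Φ t y - Φ t x‖ := by
  obtain ⟨δ, hδ, hexp⟩ := hEF.exists_forall_expansion h (isCompact_omega hb) hlam
  refine ⟨δ / 2, by positivity, fun y hyC hyx hcon => ?_⟩
  have hnear := eventually_mem_of_omega_subset hb Metric.isOpen_thickening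
    (Metric.self_subset_thickening (half_pos hδ) (omega Φ x))
  obtain ⟨T, hT⟩ := eventually_atTop.1 ((hcon.and hnear).and (eventually_ge_atTop 0))
  -- A pair that stayed close forever would double again and again. The doubling times are not
  -- controlled, but closeness holds at all times after `T`.
  have hgrow : ∀ n : ℕ, ∃ t : ℝ, T ≤ t ∧ 2 ^ n * ‖Φ T y - Φ T x‖ ≤ ‖Φ t y - Φ t x‖ := by
    intro n
    induction n with
    | zero => exact ⟨T, le_rfl, by simp⟩
    | succ n ih =>
      obtain ⟨t, ht, hle⟩ := ih
      obtain ⟨⟨h1, h2⟩, h0⟩ := hT t ht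
      obtain ⟨z, hz, hzd⟩ := Metric.mem_thickening_iff.1 h2
      have h3 : dist (Φ t y) z < δ := by
        have h4 : dist (Φ t y) (Φ t x) < δ / 2 := by rw [dist_eq_norm]; exact not_le.1 h1
        linarith [dist_triangle (Φ t y) (Φ t x) z]
      obtain ⟨τ, hτ, hle'⟩ := hexp z hz (Φ t y) (Φ t x) h3 (by linarith)
        (h.stronglyMonotone.monotone y x hyC t h0)
      refine ⟨τ + t, by linarith, ?_⟩
      rw [Φ.map_add, Φ.map_add, pow_succ]
      linarith
  have hpos : 0 < ‖Φ T y - Φ T x‖ := norm_pos_iff.2 (sub_ne_zero.2 ((flow_injective T).ne hyx))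
  obtain ⟨n, hn⟩ := pow_unbounded_of_one_lt (δ / 2 / ‖Φ T y - Φ T x‖) one_lt_two
  obtain ⟨t, ht, hle⟩ := hgrow n
  rw [div_lt_iff₀ hpos] at hn
  exact (hT t ht).1.1 (hn.le.trans hle)

/-- A point of an `ω`-compact open set whose limit set has positive exponents is approximated by
points with pseudo-ordered orbits. -/
theorem IsExpSeparation.mem_closure_pseudoOrderedSet (h : FWW Φ α k C) {D : Set V}
    (hDopen : IsOpen D) (hD : IsOmegaCompact Φ D) {x : V} (hx : x ∈ D) {E F : V → Submodule ℝ V}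
    (hEF : IsExpSeparation Φ k C (omega Φ x) E F)
    (hlam : ∀ z ∈ omega Φ x, 0 < lyapunovExponent Φ E z) :
    x ∈ closure (pseudoOrderedSet Φ C) := by
  have hb := hD.1 x hx
  obtain ⟨δ, hδ, hfreq⟩ := hEF.exists_frequently_norm_ge h hb hlam
  obtain ⟨e, heC, he0⟩ := h.exists_mem_ne_zero
  -- This compact set absorbs the orbit of every point of `D`, so the margin `κ` does not depend on
  -- the approximating point.
  set R := Metric.cthickening 1 (⋃ y ∈ D, omega Φ y) with hR
  have hRc : IsCompact R :=
    Metric.isCompact_of_isClosed_isBounded Metric.isClosed_cthickening hD.2.cthickening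
  have hRmem : ∀ y ∈ D, ∀ᶠ t : ℝ in atTop, Φ t y ∈ R := fun y hy =>
    (eventually_mem_of_omega_subset (hD.1 y hy) Metric.isOpen_thickening
      ((subset_biUnion_of_mem (u := fun y => omega Φ y) hy).trans
        (Metric.self_subset_thickening one_pos _))).mono
      fun t ht => Metric.thickening_subset_cthickening _ _ ht
  obtain ⟨κ, hκ, hmargin⟩ := h.exists_order_margin hRc hδ
  set ys : ℕ → V := fun n => x + (1 / ((n : ℝ) + 1)) • e with hys
  have hysC : ∀ n, ys n - x ∈ C := fun n => by
    rw [hys]; simp only [add_sub_cancel_left]; exact h.smul_mem heC _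
  have hysne : ∀ n, ys n ≠ x := fun n => by
    rw [hys]; simp only [ne_eq, add_eq_left, smul_eq_zero, he0, or_false]; positivity
  have hyslim : Tendsto ys atTop (𝓝 x) := by
    have := (tendsto_one_div_add_atTop_nhds_zero_nat (𝕜 := ℝ)).smul_const e
    simpa [hys] using this.const_add x
  have hp := fun n => exists_mem_omega_frequently hb (hfreq (ys n) (hysC n) (hysne n))
  choose p hpω hp using hp
  obtain ⟨q, hq, φ, hφ, hφlim⟩ := (isCompact_omega hb).tendsto_subseq hpω
  set ε := min (κ / 4) (δ / 8) with hε
  have hε0 : 0 < ε := by positivity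
  have hεκ : ε ≤ κ / 4 := min_le_left _ _
  have hεδ : ε ≤ δ / 8 := min_le_right _ _
  -- The time `s` is fixed before `n`, so continuity of `Φ s` alone brings `Φ s (ys (φ n))` near
  -- `q`.
  obtain ⟨s, hsq, hs0⟩ : ∃ s : ℝ, ‖Φ s x - q‖ < ε ∧ 0 ≤ s := by
    rw [omega, mem_omegaLimit_singleton_iff_mapClusterPt] at hq
    obtain ⟨s, hs, hs0⟩ := ((MapClusterPt.frequently hq (Metric.ball_mem_nhds q hε0)).and_eventually
      (eventually_ge_atTop 0)).exists
    exact ⟨s, by rw [← dist_eq_norm]; exact hs, hs0⟩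
  rw [mem_closure_iff_nhds]
  intro U hU
  have hlim := hyslim.comp hφ.tendsto_atTop
  have e1 : ∀ᶠ n in atTop, ‖p (φ n) - q‖ < ε := by
    filter_upwards [hφlim (Metric.ball_mem_nhds q hε0)] with n hn
    rw [← dist_eq_norm]; exact hn
  have e2 : ∀ᶠ n in atTop, ‖Φ s (ys (φ n)) - Φ s x‖ < ε := by
    filter_upwards [(((contDiff_flow_apply h.contDiff s).continuous.tendsto x).comp hlim)
      (Metric.ball_mem_nhds _ hε0)] with n hn
    rw [← dist_eq_norm]; exact hn
  obtain ⟨n, ⟨h1, h2⟩, hnU, hnD⟩ := ((e1.and e2).and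
    (hlim (inter_mem hU (hDopen.mem_nhds hx)))).exists
  set y := ys (φ n) with hy
  obtain ⟨t, ⟨ht1, ht2⟩, ht3, ht4, ht5⟩ := ((hp (φ n) ε hε0).and_eventually
    (((tendsto_atTop_add_const_right _ (-1 : ℝ) tendsto_id).eventually (hRmem y hnD)).and
      (((tendsto_atTop_add_const_right _ (-1 : ℝ) tendsto_id).eventually (hRmem x hx)).and
        (eventually_ge_atTop 1)))).exists
  have et : ∀ a, Φ 1 (Φ (t + -1) a) = Φ t a := fun a => by
    have := Φ.map_add 1 (t + -1) a
    rw [← this, add_comm t, add_neg_cancel_left]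
  -- This telescopes to `Φ t x - Φ s y`, with four terms each below `ε`. Hence `‖u‖ < κ` keeps the
  -- difference in the cone, and `‖u‖ < δ` keeps it nonzero.
  set u := (Φ t x - p (φ n)) + (p (φ n) - q) - (Φ s x - q) - (Φ s y - Φ s x) with hu
  have hun : ‖u‖ < 4 * ε := by
    have n1 := norm_sub_le ((Φ t x - p (φ n)) + (p (φ n) - q) - (Φ s x - q)) (Φ s y - Φ s x)
    have n2 := norm_sub_le ((Φ t x - p (φ n)) + (p (φ n) - q)) (Φ s x - q)
    have n3 := norm_add_le (Φ t x - p (φ n)) (p (φ n) - q)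
    rw [hu]
    linarith
  have hyu : Φ t y - Φ s y = Φ t y - Φ t x + u := by rw [hu]; abel
  refine ⟨y, hnU, isPseudoOrdered_of_ordered (s := t) (t := s) (by linarith) hs0 ?_ ?_⟩
  · intro heq
    have h3 : Φ t y - Φ t x = -u := by
      rw [eq_neg_iff_add_eq_zero, ← hyu, heq, sub_self]
    rw [h3, norm_neg] at ht1
    linarith
  · have := hmargin _ ht3 _ ht4
      (h.stronglyMonotone.monotone y x (hysC _) _ (by simp only [id]; linarith))
    simp only [id, et] at this
    rw [Ordered, hyu]
    exact this ht1 u (by linarith)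

end Expansion

end ConeFlow

theorem theorem4p5 {V : Type*} [NormedAddCommGroup V] [NormedSpace ℝ V] [FiniteDimensional ℝ V]
    (Φ : Flow ℝ V) (α : ℝ≥0) (k : ℕ) (C : Set V) (hΦ : ConeFlow.FWW Φ α k C)
    (D : Set V) (hDopen : IsOpen D) (hD : ConeFlow.IsOmegaCompact Φ D)
    (x : V) (hx : x ∈ D) :
    (∃ E F : V → Submodule ℝ V,
      ConeFlow.IsExpSeparation Φ k C (ConeFlow.omega Φ x) E F) ∧
    ∀ E F : V → Submodule ℝ V,
      ConeFlow.IsExpSeparation Φ k C (ConeFlow.omega Φ x) E F →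
      (∀ z ∈ ConeFlow.omega Φ x, 0 < ConeFlow.lyapunovExponent Φ E z) →
      x ∈ closure (ConeFlow.pseudoOrderedSet Φ C) := by
  exact ⟨hΦ.exists_isExpSeparation (ConeFlow.isCompact_omega (hD.1 x hx))
    ConeFlow.omega_invariant, fun E F hEF hlam =>
      hEF.mem_closure_pseudoOrderedSet hΦ hDopen hD hx hlam⟩
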